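/- Consider $N$ transmitter-receiver pairs (users) sharing $u$ orthogonal sub-bands. In every transmission slot user $k$ selects a set of $v_k\le u$ sub-bands, uniformly at random and independently of the other users, and transmits independent real Gaussian signals $N(0,P/v_k)$ on the selected sub-bands and $0$ on the others; signals of different users are independent. Let $h_{k,i}\in\mathbb{R}$ be the fixed gain from transmitter $k$ to receiver $i$. Receiver $i$ observes $\vec Y_i=h_{i,i}\vec X_i+\vec Z_i$ in $\mathbb{R}^u$, where $\vec Z_i=\sum_{k\neq i}h_{k,i}\vec X_k+\vec\nu_i$ and $\vec\nu_i$ is independent Gaussian noise $N(0,\sigma^2 I_u)$. Put $\gamma=P/\sigma^2$ with $P,\sigma>0$, let $S_i$ be the set of sub-bands selected by user $i$, and let $\mathscr{R}_i=\mathrm{I}(\vec X_i;\vec Y_i\mid S_i)$ be the achievable rate of user $i$ (in bits; $\log=\log_2$). Fix $u$, $v_1,\dots,v_N$, all the gains, and a user $i$ with $h_{i,i}\ne 0$. Then $\mathscr{R}_i$ is finite, and there is a function $\mathscr{R}_{i,\mathrm{lb}}$ of $\gamma$ with $\mathscr{R}_i\ge\mathscr{R}_{i,\mathrm{lb}}(\gamma)$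 for all $P,\sigma>0$, which can be written for all $\gamma>0$ as $$\mathscr{R}_{i,\mathrm{lb}}(\gamma)=\frac12\,v_i\prod_{k\neq i}\Bigl(1-\frac{v_k}{u}\Bigr)\log\gamma+\widetilde{\mathscr{R}}_{i,\mathrm{lb}}(\gamma),$$ where $\lim_{\gamma\to\infty}\widetilde{\mathscr{R}}_{i,\mathrm{lb}}(\gamma)$ exists and is finite. In particular, if $v_i\ge1$ and $v_k<u$ for all $k\ne i$, then $$\lim_{\gamma\to\infty}\frac{\mathscr{R}_{i,\mathrm{lb}}(\gamma)}{\frac12\,v_i\prod_{k\neq i}(1-\frac{v_k}{u})\log\gamma}=1.$$ -/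

import Mathlib

open MeasureTheory ProbabilityTheory Filter Topology
open scoped NNReal ENNReal

noncomputable section

namespace FrequencyHopping

/-- Mutual information `I(X;Y)` in nats of a pair `(X, Y)` with joint law `μ`: the Kullback-Leibler
divergence of the joint law from the product of its marginals. -/
def mutualInfo {α β : Type*} [MeasurableSpace α] [MeasurableSpace β] (μ : Measure (α × β)) : ℝ≥0∞ :=
  InformationTheory.klDiv μ (μ.fst.prod μ.snd)

/-- The selections of `w` out of the `u` sub-bands. -/
def bandSets (u w : ℕ) : Finset (Finset (Fin u)) :=
  Finset.powersetCard w Finset.univ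

/-- The joint sub-band selections of all users: user `k` selects `v k` of the `u` sub-bands. -/
def hopPatterns {N : ℕ} (u : ℕ) (v : Fin N → ℕ) : Finset (Fin N → Finset (Fin u)) :=
  Fintype.piFinset fun k => bandSets u (v k)

/-- Law of the vector transmitted by a user of power `P` that has selected the set `s` of `w`
sub-bands: independent components, `N(0, P / w)` on the sub-bands in `s`, and `0` elsewhere
(`gaussianReal 0 0` is the Dirac mass at `0`). -/
def signalLaw {u : ℕ} (P : ℝ≥0) (w : ℕ) (s : Finset (Fin u)) : Measure (Fin u → ℝ) :=
  Measure.pi fun j => gaussianReal 0 (if j ∈ s then P / (w : ℝ≥0) else 0)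

/-- Law of the ambient noise: independent `N(0, σ²)` on all sub-bands. -/
def ambientLaw (u : ℕ) (σ : ℝ≥0) : Measure (Fin u → ℝ) :=
  Measure.pi fun _ => gaussianReal 0 (σ ^ 2)

/-- Law of the noise plus interference vector `Z_i = ∑_{k ≠ i} h_{k,i} X_k + ν` at receiver `i`,
given that the users' sub-band selections are `T`. The signals of distinct users and the ambient
noise are independent. -/
def noiseLawGiven {N u : ℕ} (v : Fin N → ℕ) (h : Fin N → Fin N → ℝ) (P σ : ℝ≥0) (i : Fin N)
    (T : Fin N → Finset (Fin u)) : Measure (Fin u → ℝ) :=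
  ((Measure.pi fun k => signalLaw P (v k) (T k)).prod (ambientLaw u σ)).map
    fun p j => (∑ k ∈ Finset.univ.erase i, h k i * p.1 k j) + p.2 j

/-- Law of the noise plus interference vector `Z_i`: all users choose their sub-bands uniformly
and independently, that is, the selections are uniform on `hopPatterns u v`. -/
def noiseLaw {N : ℕ} (u : ℕ) (v : Fin N → ℕ) (h : Fin N → Fin N → ℝ) (P σ : ℝ≥0) (i : Fin N) :
    Measure (Fin u → ℝ) :=
  ∑ T ∈ hopPatterns u v, ((hopPatterns u v).card : ℝ≥0∞)⁻¹ • noiseLawGiven v h P σ i T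

/-- Joint law of `(X_i, Y_i)`, `Y_i = h_{i,i} X_i + Z_i`, given that user `i` selects `s`;
`Z_i` is independent of `X_i` and of the selection of user `i`. -/
def channelLaw {N u : ℕ} (v : Fin N → ℕ) (h : Fin N → Fin N → ℝ) (P σ : ℝ≥0) (i : Fin N)
    (s : Finset (Fin u)) : Measure ((Fin u → ℝ) × (Fin u → ℝ)) :=
  ((signalLaw P (v i) s).prod (noiseLaw u v h P σ i)).map
    fun p => (p.1, fun j => h i i * p.1 j + p.2 j)

/-- Achievable rate of user `i`, in bits:
`I(X_i; Y_i | S_i) = ∑ s, Pr(S_i = s) I(X_i; Y_i | S_i = s)`. -/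
def rate {N : ℕ} (u : ℕ) (v : Fin N → ℕ) (h : Fin N → Fin N → ℝ) (P σ : ℝ≥0) (i : Fin N) : ℝ≥0∞ :=
  ∑ s ∈ bandSets u (v i), ((bandSets u (v i)).card : ℝ≥0∞)⁻¹ *
    (mutualInfo (channelLaw v h P σ i s) / ENNReal.ofReal (Real.log 2))

/-- The coefficient `(1/2) v_i ∏_{k ≠ i} (1 - v_k / u)` of `log γ`. -/
def multiplexingGain {N : ℕ} (u : ℕ) (v : Fin N → ℕ) (i : Fin N) : ℝ :=
  1 / 2 * (v i : ℝ) * ∏ k ∈ Finset.univ.erase i, (1 - (v k : ℝ) / (u : ℝ))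

end FrequencyHopping

end

/-! Given all selections, every vector is Gaussian with independent coordinates. The noise plus
interference, and the output given `s`, are therefore uniform mixtures of such laws over the same
finite set `hopPatterns u v`. The mutual information is the entropy of the output minus that of the
noise (`mutualInfo_additive_noise`). The entropy of a mixture lies between the mean entropy of its
components and that mean plus the log of their number (`integral_log_gaussianMixPDF_le`,
`le_integral_log_gaussianMixPDF`). Hence revealing the hop pattern costs only a constant, and what
remains is a mean of Gaussian entropy differences.

For a fixed pattern the difference is a sum over sub-bands of nonnegative terms `1/2 log (output
variance / noise variance)`. On a sub-band of `s` free of interferers the ratio is at least `γ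
h_{i,i}² / v_i`; all other sub-bands are dropped. A given sub-band is free with probability `∏_{k ≠
i} (1 - v_k / u)`, which yields the coefficient of `log γ` and a remainder constant in `γ`. -/

namespace FrequencyHopping

/-! ### Gaussian laws with independent coordinates -/

/-- The centred Gaussian law on `ℝ^u` with independent components of variances `V`. -/
noncomputable def gaussianPi {u : ℕ} (V : Fin u → ℝ≥0) : Measure (Fin u → ℝ) :=
  Measure.pi fun j => gaussianReal 0 (V j)

instance {u : ℕ} (V : Fin u → ℝ≥0) : IsProbabilityMeasure (gaussianPi V) := by
  unfold gaussianPi; infer_instance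

/-- The density of `gaussianPi V` when no variance vanishes. -/
noncomputable def gaussianPiPDF {u : ℕ} (V : Fin u → ℝ≥0) (x : Fin u → ℝ) : ℝ :=
  ∏ j, gaussianPDFReal 0 (V j) (x j)

lemma charFunDual_gaussianPi {u : ℕ} (V : Fin u → ℝ≥0) (L : StrongDual ℝ (Fin u → ℝ)) :
    charFunDual (gaussianPi V) L
      = Complex.exp (((-(∑ j, (V j : ℝ) * L (Pi.single j 1) ^ 2) / 2 : ℝ)) : ℂ) := by
  rw [gaussianPi, charFunDual_pi, neg_div, Finset.sum_div, ← Finset.sum_neg_distrib,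
    Complex.ofReal_sum, Complex.exp_sum]
  refine Finset.prod_congr rfl fun j _ => ?_
  have hL : (L.comp (.single ℝ (fun _ : Fin u => ℝ) j))
      = (L (Pi.single j 1)) • (ContinuousLinearMap.id ℝ ℝ) := by
    ext
    simp
  have key : charFunDual (gaussianReal 0 (V j)) ((L (Pi.single j 1)) • (ContinuousLinearMap.id ℝ ℝ))
      = charFun (gaussianReal 0 (V j)) (L (Pi.single j 1)) := by
    rw [charFunDual_apply, charFun_apply_real]
    simp
  rw [hL, key, charFun_gaussianReal]
  congr 1
  push_cast
  ring

/-- Compared through characteristic functions rather than densities, because variances may vanish: a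
signal is `0` off the selected sub-bands. -/
lemma prod_gaussianPi_map_add {u : ℕ} (a : ℝ) (V W : Fin u → ℝ≥0) :
    ((gaussianPi V).prod (gaussianPi W)).map (fun p j => a * p.1 j + p.2 j)
      = gaussianPi fun j => Real.toNNReal (a ^ 2) * V j + W j := by
  let F : ((Fin u → ℝ) × (Fin u → ℝ)) →L[ℝ] (Fin u → ℝ) :=
    a • ContinuousLinearMap.fst ℝ _ _ + ContinuousLinearMap.snd ℝ _ _
  have hF : (fun (p : (Fin u → ℝ) × (Fin u → ℝ)) j => a * p.1 j + p.2 j) = F := by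
    ext p j; simp [F]
  have : IsProbabilityMeasure (((gaussianPi V).prod (gaussianPi W)).map F) :=
    Measure.isProbabilityMeasure_map (by fun_prop)
  rw [hF]
  refine Measure.ext_of_charFunDual ?_
  ext L
  rw [charFunDual_map, charFunDual_prod, charFunDual_gaussianPi, charFunDual_gaussianPi,
    charFunDual_gaussianPi, ← Complex.exp_add, ← Complex.ofReal_add]
  congr 2
  rw [← add_div, ← neg_add, ← Finset.sum_add_distrib]
  congr 2
  refine Finset.sum_congr rfl fun j _ => ?_
  simp [F, max_eq_left (sq_nonneg a)]
  ring

lemma pi_gaussianPi_prod_map_sum {N u : ℕ} (a : Fin N → ℝ) (A : Finset (Fin N))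
    (V : Fin N → Fin u → ℝ≥0) (W : Fin u → ℝ≥0) :
    ((Measure.pi fun k => gaussianPi (V k)).prod (gaussianPi W)).map
        (fun p j => (∑ k ∈ A, a k * p.1 k j) + p.2 j)
      = gaussianPi fun j => (∑ k ∈ A, Real.toNNReal (a k ^ 2) * V k j) + W j := by
  let F : ((Fin N → Fin u → ℝ) × (Fin u → ℝ)) →L[ℝ] (Fin u → ℝ) :=
    (∑ k ∈ A, a k • (ContinuousLinearMap.proj k).comp (ContinuousLinearMap.fst ℝ _ _))
      + ContinuousLinearMap.snd ℝ _ _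
  have hF : (fun (p : (Fin N → Fin u → ℝ) × (Fin u → ℝ)) j => (∑ k ∈ A, a k * p.1 k j) + p.2 j)
      = F := by
    ext p j; simp [F]
  have : IsProbabilityMeasure
      (((Measure.pi fun k => gaussianPi (V k)).prod (gaussianPi W)).map F) :=
    Measure.isProbabilityMeasure_map (by fun_prop)
  rw [hF]
  refine Measure.ext_of_charFunDual ?_
  ext L
  rw [charFunDual_map, charFunDual_prod, charFunDual_pi]
  simp_rw [charFunDual_gaussianPi]
  rw [← Complex.exp_sum, ← Complex.exp_add, ← Complex.ofReal_sum, ← Complex.ofReal_add]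
  congr 2
  rw [← Finset.sum_div, ← add_div, Finset.sum_neg_distrib, ← neg_add, Finset.sum_comm,
    ← Finset.sum_add_distrib]
  congr 2
  refine Finset.sum_congr rfl fun j _ => ?_
  have hk : ∀ k : Fin N, F (Pi.single k (Pi.single j 1), 0)
      = if k ∈ A then a k • Pi.single j (1 : ℝ) else 0 := by
    intro k
    simp only [F, add_apply, sum_apply]
    simp [Pi.single_apply]
  have h2 : F (0, Pi.single j 1) = Pi.single j 1 := by simp [F]
  simp only [ContinuousLinearMap.comp_apply, ContinuousLinearMap.inl_apply,
    ContinuousLinearMap.inr_apply, ContinuousLinearMap.single_apply, hk, h2]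
  push_cast
  rw [add_mul, Finset.sum_mul]
  congr 1
  rw [← Finset.sum_subset (Finset.subset_univ A) (fun k _ hkA => by simp [hkA])]
  refine Finset.sum_congr rfl fun k hkA => ?_
  simp [hkA, max_eq_left (sq_nonneg (a k))]
  ring

/-! ### Densities and entropies of the Gaussian laws -/

lemma measurable_gaussianPiPDF {u : ℕ} (V : Fin u → ℝ≥0) : Measurable (gaussianPiPDF V) := by
  unfold gaussianPiPDF
  exact Finset.measurable_prod _ fun j _ =>
    (measurable_gaussianPDFReal 0 (V j)).comp (measurable_pi_apply j)

lemma gaussianPiPDF_pos {u : ℕ} {V : Fin u → ℝ≥0} (hV : ∀ j, V j ≠ 0) (x : Fin u → ℝ) :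
    0 < gaussianPiPDF V x :=
  Finset.prod_pos fun j _ => gaussianPDFReal_pos 0 (V j) (x j) (hV j)

lemma gaussianPi_eq_withDensity {u : ℕ} {V : Fin u → ℝ≥0} (hV : ∀ j, V j ≠ 0) :
    gaussianPi V = volume.withDensity fun x => ENNReal.ofReal (gaussianPiPDF V x) := by
  refine (Measure.pi_eq fun s hs => ?_)
  have hint : ∀ j, IntegrableOn (gaussianPDFReal 0 (V j)) (s j) := fun j =>
    (integrable_gaussianPDFReal 0 (V j)).integrableOn
  rw [withDensity_apply _ (MeasurableSet.univ_pi hs), volume_pi, Measure.restrict_pi_pi,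
    ← ofReal_integral_eq_lintegral_ofReal]
  · unfold gaussianPiPDF
    rw [integral_fintype_prod_eq_prod, ENNReal.ofReal_prod_of_nonneg]
    · exact Finset.prod_congr rfl fun j _ => (gaussianReal_apply_eq_integral 0 (hV j) (s j)).symm
    · exact fun j _ => integral_nonneg fun x => gaussianPDFReal_nonneg _ _ _
  · exact Integrable.fintype_prod hint
  · exact ae_of_all _ fun x => (gaussianPiPDF_pos hV x).le

/-- The negative of the differential entropy of `gaussianPi V`. -/
noncomputable def negEntropy {u : ℕ} (V : Fin u → ℝ≥0) : ℝ :=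
  ∑ j, -(1 / 2) * (Real.log (2 * Real.pi * V j) + 1)

lemma log_gaussianPiPDF {u : ℕ} {V : Fin u → ℝ≥0} (hV : ∀ j, V j ≠ 0) (x : Fin u → ℝ) :
    Real.log (gaussianPiPDF V x)
      = ∑ j, (-(1 / 2) * Real.log (2 * Real.pi * V j) - (2 * V j : ℝ)⁻¹ * x j ^ 2) := by
  unfold gaussianPiPDF
  rw [Real.log_prod fun j _ => (gaussianPDFReal_pos 0 (V j) (x j) (hV j)).ne']
  refine Finset.sum_congr rfl fun j _ => ?_
  have : (0 : ℝ) < V j := by exact_mod_cast (hV j).bot_lt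
  rw [gaussianPDFReal, Real.log_mul (by positivity) (by positivity), Real.log_inv, Real.log_exp,
    Real.log_sqrt (by positivity)]
  simp only [sub_zero]
  ring

lemma integrable_sq_gaussianReal (w : ℝ≥0) : Integrable (fun x : ℝ => x ^ 2) (gaussianReal 0 w) :=
  (memLp_id_gaussianReal 2).integrable_sq

lemma integral_sq_gaussianReal (w : ℝ≥0) : ∫ x, x ^ 2 ∂(gaussianReal 0 w) = w := by
  have := variance_id_gaussianReal (μ := 0) (v := w)
  rw [variance_eq_integral (by fun_prop)] at this
  simpa using this

lemma integrable_sq_eval_gaussianPi {u : ℕ} (W : Fin u → ℝ≥0) (j : Fin u) :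
    Integrable (fun x : Fin u → ℝ => x j ^ 2) (gaussianPi W) :=
  (measurePreserving_eval (fun j => gaussianReal 0 (W j)) j).integrable_comp_of_integrable
    (integrable_sq_gaussianReal (W j))

lemma integral_sq_eval_gaussianPi {u : ℕ} (W : Fin u → ℝ≥0) (j : Fin u) :
    ∫ x : Fin u → ℝ, x j ^ 2 ∂(gaussianPi W) = W j := by
  have hm := measurePreserving_eval (fun j => gaussianReal 0 (W j)) j
  rw [← integral_sq_gaussianReal, ← hm.map_eq, integral_map hm.measurable.aemeasurable (by fun_prop)]
  rfl

/-- The log-density is quadratic, so second moments suffice. The two variance vectors are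
independent because a mixture density has to be integrated against each component. -/
lemma integrable_log_gaussianPiPDF {u : ℕ} {V : Fin u → ℝ≥0} (hV : ∀ j, V j ≠ 0)
    (W : Fin u → ℝ≥0) : Integrable (fun x => Real.log (gaussianPiPDF V x)) (gaussianPi W) := by
  simp_rw [log_gaussianPiPDF hV]
  exact integrable_finsetSum _ fun j _ =>
    (integrable_const _).sub ((integrable_sq_eval_gaussianPi W j).const_mul _)

lemma integral_log_gaussianPiPDF {u : ℕ} {V : Fin u → ℝ≥0} (hV : ∀ j, V j ≠ 0) :
    ∫ x, Real.log (gaussianPiPDF V x) ∂(gaussianPi V) = negEntropy V := by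
  simp_rw [log_gaussianPiPDF hV]
  rw [integral_finsetSum]
  swap
  · exact fun j _ => (integrable_const _).sub ((integrable_sq_eval_gaussianPi V j).const_mul _)
  refine Finset.sum_congr rfl fun j _ => ?_
  have : (V j : ℝ) ≠ 0 := by exact_mod_cast hV j
  rw [integral_sub (integrable_const _) ((integrable_sq_eval_gaussianPi V j).const_mul _),
    integral_const_mul (2 * V j : ℝ)⁻¹, integral_sq_eval_gaussianPi]
  simp
  field_simp
  ring

/-! ### Entropy of Gaussian mixtures -/

/-- The uniform mixture of the Gaussian laws of variances `V T`, `T ∈ H`. -/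
noncomputable def gaussianMix {ι : Type*} {u : ℕ} (H : Finset ι) (V : ι → Fin u → ℝ≥0) :
    Measure (Fin u → ℝ) :=
  ∑ T ∈ H, (H.card : ℝ≥0∞)⁻¹ • gaussianPi (V T)

/-- The density of `gaussianMix H V`. -/
noncomputable def gaussianMixPDF {ι : Type*} {u : ℕ} (H : Finset ι) (V : ι → Fin u → ℝ≥0)
    (x : Fin u → ℝ) : ℝ :=
  ∑ T ∈ H, (H.card : ℝ)⁻¹ * gaussianPiPDF (V T) x

section Mixture

variable {ι : Type*} {u : ℕ} {H : Finset ι} {V : ι → Fin u → ℝ≥0}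

lemma isProbabilityMeasure_gaussianMix (hH : H.Nonempty) :
    IsProbabilityMeasure (gaussianMix H V) := by
  constructor
  have : (H.card : ℝ≥0∞) ≠ 0 := by simpa using hH.ne_empty
  simp only [gaussianMix, Measure.coe_finsetSum, Finset.sum_apply, Measure.smul_apply,
    measure_univ, smul_eq_mul, mul_one, Finset.sum_const, nsmul_eq_mul]
  exact ENNReal.mul_inv_cancel this (ENNReal.natCast_ne_top _)

lemma prod_gaussianMix_map_add {ι : Type*} {u : ℕ} (H : Finset ι) (a : ℝ) (W : Fin u → ℝ≥0)
    (V : ι → Fin u → ℝ≥0) :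
    ((gaussianPi W).prod (gaussianMix H V)).map (fun p j => a * p.1 j + p.2 j)
      = gaussianMix H fun T j => Real.toNNReal (a ^ 2) * W j + V T j := by
  have hm : Measurable fun (p : (Fin u → ℝ) × (Fin u → ℝ)) j => a * p.1 j + p.2 j := by fun_prop
  have hsum : (gaussianPi W).prod (gaussianMix H V)
      = ∑ T ∈ H, (H.card : ℝ≥0∞)⁻¹ • (gaussianPi W).prod (gaussianPi (V T)) := by
    rw [gaussianMix, ← Measure.sum_coe_finset, Measure.prod_sum_right, ← Measure.sum_coe_finset]
    simp_rw [Measure.prod_smul_right]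
  rw [hsum, Measure.map_finset_sum hm.aemeasurable, gaussianMix]
  refine Finset.sum_congr rfl fun T _ => ?_
  rw [Measure.map_smul, prod_gaussianPi_map_add]

lemma measurable_gaussianMixPDF : Measurable (gaussianMixPDF H V) := by
  unfold gaussianMixPDF
  exact Finset.measurable_fun_sum _ fun T _ => (measurable_gaussianPiPDF (V T)).const_mul _

lemma gaussianMixPDF_pos (hH : H.Nonempty) (hV : ∀ T ∈ H, ∀ j, V T j ≠ 0) (x : Fin u → ℝ) :
    0 < gaussianMixPDF H V x := by
  have : (0 : ℝ) < H.card := by exact_mod_cast hH.card_pos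
  exact Finset.sum_pos (fun T hT => mul_pos (by positivity) (gaussianPiPDF_pos (hV T hT) x)) hH

lemma gaussianMix_eq_withDensity (hV : ∀ T ∈ H, ∀ j, V T j ≠ 0) :
    gaussianMix H V = volume.withDensity fun x => ENNReal.ofReal (gaussianMixPDF H V x) := by
  ext s hs
  rw [withDensity_apply _ hs]
  have h1 : ∀ x, ENNReal.ofReal (gaussianMixPDF H V x)
      = ∑ T ∈ H, (H.card : ℝ≥0∞)⁻¹ * ENNReal.ofReal (gaussianPiPDF (V T) x) := by
    intro x
    rcases H.eq_empty_or_nonempty with rfl | hH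
    · simp [gaussianMixPDF]
    have hc : (0 : ℝ) < H.card := by exact_mod_cast hH.card_pos
    rw [gaussianMixPDF, ENNReal.ofReal_sum_of_nonneg fun T hT =>
      mul_nonneg (by positivity) (gaussianPiPDF_pos (hV T hT) x).le]
    refine Finset.sum_congr rfl fun T _ => ?_
    rw [ENNReal.ofReal_mul (by positivity), ENNReal.ofReal_inv_of_pos hc, ENNReal.ofReal_natCast]
  simp_rw [h1]
  rw [lintegral_finsetSum _ fun T _ => (measurable_gaussianPiPDF (V T)).ennreal_ofReal.const_mul _]
  simp only [gaussianMix, Measure.coe_finsetSum, Finset.sum_apply, Measure.smul_apply, smul_eq_mul]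
  refine Finset.sum_congr rfl fun T hT => ?_
  rw [lintegral_const_mul _ (measurable_gaussianPiPDF (V T)).ennreal_ofReal,
    gaussianPi_eq_withDensity (hV T hT), withDensity_apply _ hs]

/-- A sum of positive terms dominates each of them. This pointwise inequality is the source of the
`log H.card` loss in the entropy bound. -/
lemma log_gaussianPiPDF_le_log_gaussianMixPDF (hV : ∀ T ∈ H, ∀ j, V T j ≠ 0) {T : ι} (hT : T ∈ H)
    (x : Fin u → ℝ) :
    Real.log (gaussianPiPDF (V T) x) - Real.log H.card ≤ Real.log (gaussianMixPDF H V x) := by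
  have hc : (0 : ℝ) < H.card := by exact_mod_cast Finset.card_pos.2 ⟨T, hT⟩
  have hp := gaussianPiPDF_pos (hV T hT) x
  rw [sub_eq_neg_add, ← Real.log_inv, ← Real.log_mul (by positivity) hp.ne']
  refine Real.log_le_log (by positivity) ?_
  exact Finset.single_le_sum (f := fun T => (H.card : ℝ)⁻¹ * gaussianPiPDF (V T) x)
    (fun S hS => mul_nonneg (by positivity) (gaussianPiPDF_pos (hV S hS) x).le) hT

lemma exists_gaussianMixPDF_le : ∃ B : ℝ, ∀ x, gaussianMixPDF H V x ≤ B := by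
  refine ⟨∑ T ∈ H, (H.card : ℝ)⁻¹ * ∏ j, (√(2 * Real.pi * V T j))⁻¹, fun x => ?_⟩
  refine Finset.sum_le_sum fun T _ => ?_
  refine mul_le_mul_of_nonneg_left ?_ (by positivity)
  refine Finset.prod_le_prod (fun j _ => gaussianPDFReal_nonneg _ _ _) fun j _ => ?_
  rw [gaussianPDFReal]
  refine mul_le_of_le_one_right (by positivity) (Real.exp_le_one_iff.2 ?_)
  rw [neg_div, neg_nonpos]
  positivity

/-- The log-density is squeezed between that of one component, shifted by a constant, and a constant
from the bounded peaks. -/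
lemma integrable_log_gaussianMixPDF_gaussianPi (hH : H.Nonempty) (hV : ∀ T ∈ H, ∀ j, V T j ≠ 0)
    (W : Fin u → ℝ≥0) : Integrable (fun x => Real.log (gaussianMixPDF H V x)) (gaussianPi W) := by
  obtain ⟨T, hT⟩ := hH
  obtain ⟨B, hB⟩ := exists_gaussianMixPDF_le (H := H) (V := V)
  refine integrable_of_le_of_le
    (Real.measurable_log.comp measurable_gaussianMixPDF).aestronglyMeasurable
    (ae_of_all _ fun x => log_gaussianPiPDF_le_log_gaussianMixPDF hV hT x)
    (ae_of_all _ fun x => Real.log_le_log (gaussianMixPDF_pos ⟨T, hT⟩ hV x) (hB x))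
    ((integrable_log_gaussianPiPDF (hV T hT) W).sub (integrable_const _)) (integrable_const _)

lemma integrable_gaussianMix {f : (Fin u → ℝ) → ℝ} (hH : H.Nonempty)
    (hf : ∀ T ∈ H, Integrable f (gaussianPi (V T))) : Integrable f (gaussianMix H V) := by
  refine integrable_finsetSum_measure.2 fun T hT => (hf T hT).smul_measure ?_
  simpa using hH.ne_empty

lemma integral_gaussianMix {f : (Fin u → ℝ) → ℝ} (hH : H.Nonempty)
    (hf : ∀ T ∈ H, Integrable f (gaussianPi (V T))) :
    ∫ x, f x ∂(gaussianMix H V) = (H.card : ℝ)⁻¹ * ∑ T ∈ H, ∫ x, f x ∂(gaussianPi (V T)) := by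
  have : (H.card : ℝ≥0∞)⁻¹ ≠ ⊤ := by simpa using hH.ne_empty
  rw [gaussianMix, integral_finsetSum_measure fun T hT => (hf T hT).smul_measure this,
    Finset.mul_sum]
  simp [integral_smul_measure]

lemma integrable_log_gaussianMixPDF (hH : H.Nonempty) (hV : ∀ T ∈ H, ∀ j, V T j ≠ 0) :
    Integrable (fun x => Real.log (gaussianMixPDF H V x)) (gaussianMix H V) :=
  integrable_gaussianMix hH fun T _ => integrable_log_gaussianMixPDF_gaussianPi hH hV (V T)

/-- The entropy of a mixture is at most the mean entropy plus the entropy of the mixing law. -/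
lemma le_integral_log_gaussianMixPDF (hH : H.Nonempty) (hV : ∀ T ∈ H, ∀ j, V T j ≠ 0) :
    (H.card : ℝ)⁻¹ * ∑ T ∈ H, negEntropy (V T) - Real.log H.card
      ≤ ∫ x, Real.log (gaussianMixPDF H V x) ∂(gaussianMix H V) := by
  have hc : (0 : ℝ) < H.card := by exact_mod_cast hH.card_pos
  rw [integral_gaussianMix hH fun T _ => integrable_log_gaussianMixPDF_gaussianPi hH hV (V T)]
  have h1 : ∀ T ∈ H, negEntropy (V T) - Real.log H.card
      ≤ ∫ x, Real.log (gaussianMixPDF H V x) ∂(gaussianPi (V T)) := by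
    intro T hT
    have hi := integrable_log_gaussianPiPDF (hV T hT) (V T)
    calc negEntropy (V T) - Real.log H.card
        = ∫ x, (Real.log (gaussianPiPDF (V T) x) - Real.log H.card) ∂(gaussianPi (V T)) := by
          rw [integral_sub hi (integrable_const _), integral_log_gaussianPiPDF (hV T hT)]
          simp
      _ ≤ _ := integral_mono (hi.sub (integrable_const _))
          (integrable_log_gaussianMixPDF_gaussianPi hH hV (V T))
          fun x => log_gaussianPiPDF_le_log_gaussianMixPDF hV hT x
  calc (H.card : ℝ)⁻¹ * ∑ T ∈ H, negEntropy (V T) - Real.log H.card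
      = (H.card : ℝ)⁻¹ * ∑ T ∈ H, (negEntropy (V T) - Real.log H.card) := by
        rw [Finset.sum_sub_distrib, Finset.sum_const, nsmul_eq_mul]
        field_simp
    _ ≤ _ := mul_le_mul_of_nonneg_left (Finset.sum_le_sum h1) (by positivity)

/-- The entropy of a mixture is at least the mean entropy. -/
lemma integral_log_gaussianMixPDF_le (hH : H.Nonempty) (hV : ∀ T ∈ H, ∀ j, V T j ≠ 0) :
    ∫ x, Real.log (gaussianMixPDF H V x) ∂(gaussianMix H V)
      ≤ (H.card : ℝ)⁻¹ * ∑ T ∈ H, negEntropy (V T) := by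
  have hprob := isProbabilityMeasure_gaussianMix (V := V) hH
  rw [integral_gaussianMix hH fun T _ => integrable_log_gaussianMixPDF_gaussianPi hH hV (V T)]
  refine mul_le_mul_of_nonneg_left (Finset.sum_le_sum fun T hT => ?_) (by positivity)
  have hf := gaussianMixPDF_pos hH hV
  have hp := gaussianPiPDF_pos (hV T hT)
  have hif := integrable_log_gaussianMixPDF_gaussianPi hH hV (V T)
  have hip := integrable_log_gaussianPiPDF (hV T hT) (V T)
  -- Gibbs' inequality: the ratio of the mixture density to a component density has mean `1` under
  -- the component, so `log t ≤ t - 1` makes the mean of its logarithm nonpositive.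
  have hlin : ∫⁻ x, ENNReal.ofReal (gaussianMixPDF H V x / gaussianPiPDF (V T) x)
      ∂(gaussianPi (V T)) = 1 := by
    have hm1 := measurable_gaussianMixPDF (H := H) (V := V)
    have hm2 := measurable_gaussianPiPDF (V T)
    rw [gaussianPi_eq_withDensity (hV T hT), lintegral_withDensity_eq_lintegral_mul _
      (measurable_gaussianPiPDF (V T)).ennreal_ofReal
      (by fun_prop)]
    calc _ = ∫⁻ x, ENNReal.ofReal (gaussianMixPDF H V x) := by
          refine lintegral_congr fun x => ?_
          rw [Pi.mul_apply, ← ENNReal.ofReal_mul (hp x).le, mul_div_cancel₀ _ (hp x).ne']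
      _ = gaussianMix H V Set.univ := by
          rw [gaussianMix_eq_withDensity hV, withDensity_apply _ MeasurableSet.univ,
            Measure.restrict_univ]
      _ = 1 := measure_univ
  have hnn : ∀ x, 0 ≤ gaussianMixPDF H V x / gaussianPiPDF (V T) x := fun x =>
    div_nonneg (hf x).le (hp x).le
  have hmeas : AEStronglyMeasurable (fun x => gaussianMixPDF H V x / gaussianPiPDF (V T) x)
      (gaussianPi (V T)) :=
    (measurable_gaussianMixPDF.div (measurable_gaussianPiPDF (V T))).aestronglyMeasurable
  have hint : Integrable (fun x => gaussianMixPDF H V x / gaussianPiPDF (V T) x)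
      (gaussianPi (V T)) :=
    (lintegral_ofReal_ne_top_iff_integrable hmeas (ae_of_all _ hnn)).1 (by simp [hlin])
  have hval : ∫ x, gaussianMixPDF H V x / gaussianPiPDF (V T) x ∂(gaussianPi (V T)) = 1 := by
    rw [integral_eq_lintegral_of_nonneg_ae (ae_of_all _ hnn) hmeas, hlin, ENNReal.toReal_one]
  have hmono : ∫ x, Real.log (gaussianMixPDF H V x) - Real.log (gaussianPiPDF (V T) x)
        ∂(gaussianPi (V T))
      ≤ ∫ x, (gaussianMixPDF H V x / gaussianPiPDF (V T) x - 1) ∂(gaussianPi (V T)) := by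
    refine integral_mono (hif.sub hip) (hint.sub (integrable_const _)) fun x => ?_
    simp only
    rw [← Real.log_div (hf x).ne' (hp x).ne']
    exact Real.log_le_sub_one_of_pos (div_pos (hf x) (hp x))
  rw [integral_sub hif hip, integral_sub hint (integrable_const _), hval,
    integral_log_gaussianPiPDF (hV T hT)] at hmono
  simp at hmono
  exact hmono

end Mixture

/-! ### Mutual information as a difference of entropies -/

/-- The mutual information across an additive noise channel is the difference of the differential
entropies of the output and of the noise. -/
lemma mutualInfo_additive_noise {u : ℕ} (a : ℝ) (μ ν ρ : Measure (Fin u → ℝ))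
    [IsProbabilityMeasure μ] [IsProbabilityMeasure ν] [IsProbabilityMeasure ρ]
    {f g : (Fin u → ℝ) → ℝ} (hfm : Measurable f) (hgm : Measurable g)
    (hf : ∀ x, 0 < f x) (hg : ∀ x, 0 < g x)
    (hν : ν = volume.withDensity fun x => ENNReal.ofReal (f x))
    (hρ : ρ = volume.withDensity fun x => ENNReal.ofReal (g x))
    (hmap : (μ.prod ν).map (fun p j => a * p.1 j + p.2 j) = ρ)
    (hif : Integrable (fun x => Real.log (f x)) ν) (hig : Integrable (fun x => Real.log (g x)) ρ) :
    mutualInfo ((μ.prod ν).map fun p => (p.1, fun j => a * p.1 j + p.2 j)) ≠ ⊤ ∧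
    (mutualInfo ((μ.prod ν).map fun p => (p.1, fun j => a * p.1 j + p.2 j))).toReal
      = ∫ x, Real.log (f x) ∂ν - ∫ x, Real.log (g x) ∂ρ := by
  set S : (Fin u → ℝ) × (Fin u → ℝ) → (Fin u → ℝ) × (Fin u → ℝ) :=
    fun p => (p.1, fun j => a * p.1 j + p.2 j) with hS
  have hSm : Measurable S := by fun_prop
  set J := (μ.prod ν).map S with hJ
  have hJp : IsProbabilityMeasure J := Measure.isProbabilityMeasure_map hSm.aemeasurable
  have hfst : J.fst = μ := by
    rw [Measure.fst, hJ, Measure.map_map measurable_fst hSm]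
    exact Measure.fst_prod
  have hsnd : J.snd = ρ := by
    rw [Measure.snd, hJ, Measure.map_map measurable_snd hSm, ← hmap]
    rfl
  -- The input law `μ` may be singular, so the reference measure is `μ.prod volume`. The shear `S`
  -- translates each fibre and preserves it, so the joint law has density `f (y - a x)`.
  have hSpres : MeasurePreserving S (μ.prod volume) (μ.prod volume) := by
    refine (MeasurePreserving.id μ).skew_product (g := fun (x z : Fin u → ℝ) j => a * x j + z j)
      (by fun_prop)
      (ae_of_all _ fun x => ?_)
    exact (measurePreserving_add_left volume (fun j => a * x j)).map_eq
  set F : (Fin u → ℝ) × (Fin u → ℝ) → ℝ := fun p => f (fun j => p.2 j - a * p.1 j) with hF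
  have hFm : Measurable F := hfm.comp (by fun_prop)
  have hFS : ∀ p, F (S p) = f p.2 := fun p => by simp [hF, hS]
  have hJd : J = (μ.prod volume).withDensity fun p => ENNReal.ofReal (F p) := by
    ext s hs
    rw [hJ, Measure.map_apply hSm hs, hν, prod_withDensity_right hfm.ennreal_ofReal,
      withDensity_apply _ (hSm hs), withDensity_apply _ hs,
      ← hSpres.setLIntegral_comp_preimage hs hFm.ennreal_ofReal]
    simp_rw [hFS]
  set R : (Fin u → ℝ) × (Fin u → ℝ) → ℝ≥0∞ := fun p => ENNReal.ofReal (F p / g p.2) with hR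
  have hRm : Measurable R := (hFm.div (hgm.comp measurable_snd)).ennreal_ofReal
  -- Dividing by the output density gives the density `f (y - a x) / g y` relative to the product of
  -- the marginals; its logarithm splits into the two entropy integrands.
  have hJR : J = (μ.prod ρ).withDensity R := by
    rw [hJd, hρ, prod_withDensity_right hgm.ennreal_ofReal,
      ← withDensity_mul (μ.prod volume) (f := fun p => ENNReal.ofReal (g p.2))
        (hgm.ennreal_ofReal.comp measurable_snd) hRm]
    congr 1
    ext p
    simp only [Pi.mul_apply, hR]
    rw [← ENNReal.ofReal_mul (hg _).le, mul_div_cancel₀ _ (hg _).ne']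
  have hac : J ≪ μ.prod ρ := hJR ▸ withDensity_absolutelyContinuous _ _
  have hllr : llr J (μ.prod ρ) =ᵐ[J] fun p => Real.log (F p) - Real.log (g p.2) := by
    have h0 : J.rnDeriv (μ.prod ρ) =ᵐ[μ.prod ρ] R := by
      conv_lhs => rw [hJR]
      exact Measure.rnDeriv_withDensity _ hRm
    filter_upwards [hac.ae_le h0] with p hp
    rw [llr, hp, hR, ENNReal.toReal_ofReal (div_nonneg (hf _).le (hg _).le),
      Real.log_div (hf _).ne' (hg _).ne']
  have hlm : Measurable fun p : (Fin u → ℝ) × (Fin u → ℝ) => Real.log (F p) :=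
    Real.measurable_log.comp hFm
  have hlgm : Measurable fun x => Real.log (g x) := Real.measurable_log.comp hgm
  have hi1 : Integrable (fun p => Real.log (F p)) J := by
    rw [hJ, integrable_map_measure hlm.aestronglyMeasurable hSm.aemeasurable]
    simp only [Function.comp_def, hFS]
    exact hif.comp_snd μ
  have hi2 : Integrable (fun p : (Fin u → ℝ) × (Fin u → ℝ) => Real.log (g p.2)) J := by
    rw [← hsnd, Measure.snd,
      integrable_map_measure hlgm.aestronglyMeasurable measurable_snd.aemeasurable] at hig
    exact hig
  have hv1 : ∫ p, Real.log (F p) ∂J = ∫ x, Real.log (f x) ∂ν := by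
    rw [hJ, integral_map hSm.aemeasurable hlm.aestronglyMeasurable]
    simp only [hFS]
    rw [integral_fun_snd (fun x => Real.log (f x))]
    simp
  have hv2 : ∫ p, Real.log (g p.2) ∂J = ∫ x, Real.log (g x) ∂ρ := by
    rw [← hsnd, Measure.snd, integral_map measurable_snd.aemeasurable hlgm.aestronglyMeasurable]
  have hint : Integrable (llr J (μ.prod ρ)) J := (integrable_congr hllr).2 (hi1.sub hi2)
  rw [mutualInfo, hfst, hsnd]
  refine ⟨InformationTheory.klDiv_ne_top hac hint, ?_⟩
  rw [InformationTheory.toReal_klDiv_of_measure_eq hac (by simp), integral_congr_ae hllr,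
    integral_sub hi1 hi2, hv1, hv2]

/-! ### Counting hop patterns -/

section Channel

variable {N u : ℕ}

lemma bandSets_nonempty {w : ℕ} (hw : w ≤ u) : (bandSets u w).Nonempty := by
  rw [bandSets, Finset.powersetCard_nonempty]
  simpa using hw

lemma hopPatterns_nonempty {v : Fin N → ℕ} (hv : ∀ k, v k ≤ u) : (hopPatterns u v).Nonempty := by
  rw [hopPatterns, Fintype.piFinset_nonempty]
  exact fun k => bandSets_nonempty (hv k)

lemma card_bandSets_filter_notMem {w : ℕ} (hw : w ≤ u) (j : Fin u) :
    (((bandSets u w).filter (j ∉ ·)).card : ℝ)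
      = (bandSets u w).card * (1 - (w : ℝ) / (u : ℝ)) := by
  have hset : (bandSets u w).filter (j ∉ ·) = Finset.powersetCard w (Finset.univ.erase j) := by
    ext s
    simp only [bandSets, Finset.mem_filter, Finset.mem_powersetCard, Finset.subset_univ, true_and,
      Finset.subset_erase]
    tauto
  obtain ⟨n, rfl⟩ : ∃ n, u = n + 1 := ⟨u - 1, by have := j.pos; omega⟩
  rw [hset, bandSets, Finset.card_powersetCard, Finset.card_powersetCard,
    Finset.card_erase_of_mem (Finset.mem_univ j), Finset.card_univ, Fintype.card_fin,
    Nat.add_sub_cancel]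
  -- The proportion is `C(n, w) / C(n + 1, w) = (n + 1 - w) / (n + 1)`, with `u = n + 1`.
  have := Nat.choose_mul_succ_eq n w
  have h2 : (n.choose w : ℝ) * ((n : ℝ) + 1) = (n + 1).choose w * ((n : ℝ) + 1 - w) := by
    have := congrArg (Nat.cast (R := ℝ)) this
    push_cast [Nat.cast_sub hw] at this
    exact this
  have hn : (n : ℝ) + 1 ≠ 0 := by positivity
  push_cast
  field_simp
  exact h2

/-- The probability that no user other than `i` selects the sub-band `j`. -/
lemma card_hopPatterns_filter_forall_notMem {v : Fin N → ℕ} (hv : ∀ k, v k ≤ u) (i : Fin N)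
    (j : Fin u) :
    (((hopPatterns u v).filter fun T => ∀ k ∈ Finset.univ.erase i, j ∉ T k).card : ℝ)
      = (hopPatterns u v).card * ∏ k ∈ Finset.univ.erase i, (1 - (v k : ℝ) / (u : ℝ)) := by
  -- User `i` is unconstrained and the others are constrained separately, so the set is still a
  -- product and its cardinality factors.
  have hset : ((hopPatterns u v).filter fun T => ∀ k ∈ Finset.univ.erase i, j ∉ T k)
      = Fintype.piFinset fun k =>
        if k = i then bandSets u (v k) else (bandSets u (v k)).filter (j ∉ ·) := by
    ext T
    simp only [hopPatterns, Finset.mem_filter, Fintype.mem_piFinset, Finset.mem_erase,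
      Finset.mem_univ, and_true]
    constructor
    · rintro ⟨h1, h2⟩ k
      by_cases hk : k = i
      · simpa [hk] using h1 i
      · simpa [hk] using ⟨h1 k, h2 k hk⟩
    · intro h1
      refine ⟨fun k => ?_, fun k hk => ?_⟩
      · have := h1 k
        by_cases hk : k = i
        · simpa [hk] using h1 i
        · simp only [hk, if_false, Finset.mem_filter] at this
          exact this.1
      · have := h1 k
        simp only [hk, if_false, Finset.mem_filter] at this
        exact this.2
  rw [hset, hopPatterns, Fintype.card_piFinset, Fintype.card_piFinset,
    ← Finset.mul_prod_erase _ _ (Finset.mem_univ i),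
    ← Finset.mul_prod_erase (a := i) _ (fun k => (bandSets u (v k)).card) (Finset.mem_univ i)]
  push_cast
  rw [if_pos rfl, mul_assoc, ← Finset.prod_mul_distrib]
  congr 1
  refine Finset.prod_congr rfl fun k hk => ?_
  rw [if_neg (Finset.ne_of_mem_erase hk), card_bandSets_filter_notMem (hv k)]

/-! ### Conditional variances and the bound for a fixed selection -/

/-- The variance of the noise plus interference on each sub-band, given the selections `T`. -/
noncomputable def noiseVar (v : Fin N → ℕ) (h : Fin N → Fin N → ℝ) (P σ : ℝ≥0) (i : Fin N)
    (T : Fin N → Finset (Fin u)) (j : Fin u) : ℝ≥0 :=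
  (∑ k ∈ Finset.univ.erase i,
    Real.toNNReal (h k i ^ 2) * if j ∈ T k then P / (v k : ℝ≥0) else 0) + σ ^ 2

/-- The variance of the received signal on each sub-band, given the selections `s` of user `i` and
`T` of its interferers. -/
noncomputable def outputVar (v : Fin N → ℕ) (h : Fin N → Fin N → ℝ) (P σ : ℝ≥0) (i : Fin N)
    (s : Finset (Fin u)) (T : Fin N → Finset (Fin u)) (j : Fin u) : ℝ≥0 :=
  Real.toNNReal (h i i ^ 2) * (if j ∈ s then P / (v i : ℝ≥0) else 0) + noiseVar v h P σ i T j

lemma noiseLaw_eq_gaussianMix (v : Fin N → ℕ) (h : Fin N → Fin N → ℝ) (P σ : ℝ≥0) (i : Fin N) :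
    noiseLaw u v h P σ i = gaussianMix (hopPatterns u v) (noiseVar v h P σ i) :=
  Finset.sum_congr rfl fun T _ => congrArg _ <|
    pi_gaussianPi_prod_map_sum (fun k => h k i) (Finset.univ.erase i)
      (fun k j => if j ∈ T k then P / (v k : ℝ≥0) else 0) fun _ => σ ^ 2

lemma noiseVar_ne_zero {v : Fin N → ℕ} {h : Fin N → Fin N → ℝ} {P σ : ℝ≥0} (hσ : 0 < σ)
    (i : Fin N) (T : Fin N → Finset (Fin u)) (j : Fin u) : noiseVar v h P σ i T j ≠ 0 :=
  (add_pos_of_nonneg_of_pos zero_le (pow_pos hσ 2)).ne'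

lemma outputVar_ne_zero {v : Fin N → ℕ} {h : Fin N → Fin N → ℝ} {P σ : ℝ≥0} (hσ : 0 < σ)
    (i : Fin N) (s : Finset (Fin u)) (T : Fin N → Finset (Fin u)) (j : Fin u) :
    outputVar v h P σ i s T j ≠ 0 :=
  (add_pos_of_nonneg_of_pos zero_le (noiseVar_ne_zero hσ i T j).bot_lt).ne'

/-- The mutual information given the selection of user `i` is at least the mutual information when
the selections of the interferers are known as well, minus the entropy of these selections. -/
lemma mutualInfo_channelLaw {v : Fin N → ℕ} (hv : ∀ k, v k ≤ u) (h : Fin N → Fin N → ℝ)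
    (P : ℝ≥0) {σ : ℝ≥0} (hσ : 0 < σ) (i : Fin N) (s : Finset (Fin u)) :
    mutualInfo (channelLaw v h P σ i s) ≠ ⊤ ∧
    ((hopPatterns u v).card : ℝ)⁻¹ * ∑ T ∈ hopPatterns u v,
        (negEntropy (noiseVar v h P σ i T) - negEntropy (outputVar v h P σ i s T))
      - Real.log (hopPatterns u v).card ≤ (mutualInfo (channelLaw v h P σ i s)).toReal := by
  have hH := hopPatterns_nonempty hv
  have hVn : ∀ T ∈ hopPatterns u v, ∀ j, noiseVar v h P σ i T j ≠ 0 :=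
    fun T _ j => noiseVar_ne_zero hσ i T j
  have hVo : ∀ T ∈ hopPatterns u v, ∀ j, outputVar v h P σ i s T j ≠ 0 :=
    fun T _ j => outputVar_ne_zero hσ i s T j
  have := isProbabilityMeasure_gaussianMix (V := noiseVar v h P σ i) hH
  have := isProbabilityMeasure_gaussianMix (V := outputVar v h P σ i s) hH
  obtain ⟨h1, h2⟩ := mutualInfo_additive_noise (h i i)
    (gaussianPi fun j => if j ∈ s then P / (v i : ℝ≥0) else 0)
    (gaussianMix (hopPatterns u v) (noiseVar v h P σ i))
    (gaussianMix (hopPatterns u v) (outputVar v h P σ i s))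
    measurable_gaussianMixPDF measurable_gaussianMixPDF
    (gaussianMixPDF_pos hH hVn) (gaussianMixPDF_pos hH hVo)
    (gaussianMix_eq_withDensity hVn) (gaussianMix_eq_withDensity hVo)
    (prod_gaussianMix_map_add _ _ _ _)
    (integrable_log_gaussianMixPDF hH hVn) (integrable_log_gaussianMixPDF hH hVo)
  have hch : channelLaw v h P σ i s
      = ((gaussianPi fun j => if j ∈ s then P / (v i : ℝ≥0) else 0).prod
          (gaussianMix (hopPatterns u v) (noiseVar v h P σ i))).map
        fun p => (p.1, fun j => h i i * p.1 j + p.2 j) := by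
    rw [channelLaw, noiseLaw_eq_gaussianMix]
    rfl
  rw [hch]
  refine ⟨h1, ?_⟩
  rw [h2, Finset.sum_sub_distrib, mul_sub]
  -- The noise entropy is bounded above and the output entropy below, so `log card` is lost only
  -- once.
  linarith [le_integral_log_gaussianMixPDF hH hVn, integral_log_gaussianMixPDF_le hH hVo]

lemma noiseVar_eq_of_forall_notMem {v : Fin N → ℕ} {h : Fin N → Fin N → ℝ} {P σ : ℝ≥0} {i : Fin N}
    {T : Fin N → Finset (Fin u)} {j : Fin u} (hT : ∀ k ∈ Finset.univ.erase i, j ∉ T k) :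
    noiseVar v h P σ i T j = σ ^ 2 := by
  rw [noiseVar, Finset.sum_eq_zero fun k hk => by simp [hT k hk], zero_add]

/-- The signal only adds variance, so every sub-band contributes a nonnegative term and all but the
interference-free ones in `s` may be discarded. -/
lemma le_negEntropy_sub_negEntropy {v : Fin N → ℕ} {h : Fin N → Fin N → ℝ} {P σ : ℝ≥0}
    (hP : 0 < P) (hσ : 0 < σ) {i : Fin N} (hi : h i i ≠ 0) {s : Finset (Fin u)}
    (hs : s.card = v i) (T : Fin N → Finset (Fin u)) :
    ∑ j ∈ s, (if ∀ k ∈ Finset.univ.erase i, j ∉ T k then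
        1 / 2 * (Real.log ((P : ℝ) / (σ : ℝ) ^ 2) + Real.log (h i i ^ 2 / v i)) else 0)
      ≤ negEntropy (noiseVar v h P σ i T) - negEntropy (outputVar v h P σ i s T) := by
  rw [negEntropy, negEntropy, ← Finset.sum_sub_distrib]
  have hterm : ∀ j, (-(1 / 2) * (Real.log (2 * Real.pi * noiseVar v h P σ i T j) + 1)
        - -(1 / 2) * (Real.log (2 * Real.pi * outputVar v h P σ i s T j) + 1))
      = 1 / 2 * (Real.log (outputVar v h P σ i s T j) - Real.log (noiseVar v h P σ i T j)) := by
    intro j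
    have h1 : ((noiseVar v h P σ i T j : ℝ≥0) : ℝ) ≠ 0 := by
      exact_mod_cast noiseVar_ne_zero hσ i T j
    have h2 : ((outputVar v h P σ i s T j : ℝ≥0) : ℝ) ≠ 0 := by
      exact_mod_cast outputVar_ne_zero hσ i s T j
    rw [Real.log_mul (by positivity) h1, Real.log_mul (by positivity) h2]
    ring
  have hnn : ∀ j,
      0 ≤ 1 / 2 * (Real.log (outputVar v h P σ i s T j) - Real.log (noiseVar v h P σ i T j)) := by
    intro j
    have h1 : (0 : ℝ) < noiseVar v h P σ i T j := by
      exact_mod_cast (noiseVar_ne_zero hσ i T j).bot_lt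
    have h2 : (noiseVar v h P σ i T j : ℝ) ≤ outputVar v h P σ i s T j := by
      exact_mod_cast (le_add_of_nonneg_left zero_le :
        noiseVar v h P σ i T j ≤ outputVar v h P σ i s T j)
    have := Real.log_le_log h1 h2
    linarith
  simp_rw [hterm]
  refine le_trans (Finset.sum_le_sum fun j hj => ?_)
    (Finset.sum_le_sum_of_subset_of_nonneg (Finset.subset_univ s) fun j _ _ => hnn j)
  split_ifs with hfree
  · have hw : (0 : ℝ) < v i := by
      rw [← hs]
      exact_mod_cast Finset.card_pos.2 ⟨j, hj⟩
    have hP' : (0 : ℝ) < P := hP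
    have hσ' : (0 : ℝ) < σ := hσ
    have hh : 0 < h i i ^ 2 := by positivity
    have hout : (outputVar v h P σ i s T j : ℝ) = h i i ^ 2 * (P / v i) + σ ^ 2 := by
      rw [outputVar, noiseVar_eq_of_forall_notMem hfree, if_pos hj]
      push_cast
      rw [Real.coe_toNNReal _ hh.le]
    rw [hout, noiseVar_eq_of_forall_notMem hfree, NNReal.coe_pow, ← Real.log_mul (by positivity)
      (by positivity), ← Real.log_div (by positivity) (by positivity)]
    refine mul_le_mul_of_nonneg_left (Real.log_le_log (by positivity) ?_) (by norm_num)
    -- On a free sub-band the variance ratio is `1 + γ h_{i,i}² / v_i`; the `1` is dropped.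
    rw [show (P : ℝ) / σ ^ 2 * (h i i ^ 2 / v i) = h i i ^ 2 * (P / v i) / σ ^ 2 by ring]
    gcongr
    exact le_add_of_nonneg_right (by positivity)
  · exact hnn j

/-! ### The lower bound on the rate -/

/-- The constant term of the lower bound on the rate, in bits. -/
noncomputable def rateOffset (u : ℕ) (v : Fin N → ℕ) (h : Fin N → Fin N → ℝ) (i : Fin N) : ℝ :=
  multiplexingGain u v i * Real.logb 2 (h i i ^ 2 / v i) - Real.logb 2 (hopPatterns u v).card

lemma le_mutualInfo_channelLaw {v : Fin N → ℕ} (hv : ∀ k, v k ≤ u) {h : Fin N → Fin N → ℝ}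
    {P σ : ℝ≥0} (hP : 0 < P) (hσ : 0 < σ) {i : Fin N} (hi : h i i ≠ 0) {s : Finset (Fin u)}
    (hs : s ∈ bandSets u (v i)) :
    multiplexingGain u v i * Real.logb 2 ((P : ℝ) / (σ : ℝ) ^ 2) + rateOffset u v h i
      ≤ (mutualInfo (channelLaw v h P σ i s) / ENNReal.ofReal (Real.log 2)).toReal := by
  have hcard : s.card = v i := (Finset.mem_powersetCard.1 hs).2
  have hlog2 : 0 < Real.log 2 := Real.log_pos one_lt_two
  have hH : (0 : ℝ) < (hopPatterns u v).card := by
    exact_mod_cast (hopPatterns_nonempty hv).card_pos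
  rw [ENNReal.toReal_div, ENNReal.toReal_ofReal hlog2.le, le_div_iff₀ hlog2]
  refine le_trans (le_of_eq ?_) (le_trans (sub_le_sub_right (mul_le_mul_of_nonneg_left
    (Finset.sum_le_sum fun T _ => le_negEntropy_sub_negEntropy hP hσ hi hcard T)
    (inv_nonneg.2 hH.le)) _) (mutualInfo_channelLaw hv h P hσ i s).2)
  -- Summing over patterns first counts, for each of the `v i` sub-bands of `s`, the patterns
  -- leaving it free; this count does not depend on the sub-band.
  rw [Finset.sum_comm]
  simp_rw [← Finset.sum_filter, Finset.sum_const, nsmul_eq_mul,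
    card_hopPatterns_filter_forall_notMem hv i]
  rw [Finset.sum_const, hcard, nsmul_eq_mul, rateOffset, multiplexingGain]
  simp only [Real.logb]
  field_simp
  ring

lemma rate_ne_top {v : Fin N → ℕ} (hv : ∀ k, v k ≤ u) (h : Fin N → Fin N → ℝ) (P : ℝ≥0) {σ : ℝ≥0}
    (hσ : 0 < σ) (i : Fin N) : rate u v h P σ i ≠ ⊤ := by
  refine ENNReal.sum_ne_top.2 fun s _ => ENNReal.mul_ne_top ?_ (ENNReal.div_ne_top
    (mutualInfo_channelLaw hv h P hσ i s).1 ?_)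
  · simpa using (bandSets_nonempty (hv i)).ne_empty
  · simpa using Real.log_pos one_lt_two

/-- The bound on the conditional mutual information is the same for every `s`, so it survives
averaging over the selections of user `i`. -/
lemma le_toReal_rate {v : Fin N → ℕ} (hv : ∀ k, v k ≤ u) {h : Fin N → Fin N → ℝ}
    {P σ : ℝ≥0} (hP : 0 < P) (hσ : 0 < σ) {i : Fin N} (hi : h i i ≠ 0) :
    multiplexingGain u v i * Real.logb 2 ((P : ℝ) / (σ : ℝ) ^ 2) + rateOffset u v h i
      ≤ (rate u v h P σ i).toReal := by
  have hB : (0 : ℝ) < (bandSets u (v i)).card := by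
    exact_mod_cast (bandSets_nonempty (hv i)).card_pos
  have hfin := ENNReal.sum_ne_top.1 (rate_ne_top hv h P hσ i)
  rw [rate, ENNReal.toReal_sum hfin]
  set b := multiplexingGain u v i * Real.logb 2 ((P : ℝ) / (σ : ℝ) ^ 2) + rateOffset u v h i
  calc b = ∑ s ∈ bandSets u (v i), ((bandSets u (v i)).card : ℝ)⁻¹ * b := by
        rw [Finset.sum_const, nsmul_eq_mul, mul_inv_cancel_left₀ hB.ne']
    _ ≤ _ := Finset.sum_le_sum fun s hs => by
        rw [ENNReal.toReal_mul, ENNReal.toReal_inv, ENNReal.toReal_natCast]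
        exact mul_le_mul_of_nonneg_left (le_mutualInfo_channelLaw hv hP hσ hi hs) (by positivity)

lemma multiplexingGain_pos {v : Fin N → ℕ} {i : Fin N} (hvi : 1 ≤ v i)
    (hvk : ∀ k, k ≠ i → v k < u) : 0 < multiplexingGain u v i := by
  have hvi' : (0 : ℝ) < v i := by exact_mod_cast hvi
  refine mul_pos (by positivity) (Finset.prod_pos fun k hk => ?_)
  have hlt : (v k : ℝ) < u := by exact_mod_cast hvk k (Finset.ne_of_mem_erase hk)
  have hu : (0 : ℝ) < u := lt_of_le_of_lt (by positivity) hlt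
  rw [sub_pos, div_lt_one hu]
  exact hlt

end Channel

end FrequencyHopping

theorem theorem2 (N u : ℕ) (v : Fin N → ℕ) (hv : ∀ k, v k ≤ u)
    (h : Fin N → Fin N → ℝ) (i : Fin N) (hi : h i i ≠ 0) :
    ∃ Rlb Rlb' : ℝ → ℝ,
      -- a lower bound on the (finite) achievable rate that depends on `P`, `σ` only through the SNR
      (∀ P σ : ℝ≥0, 0 < P → 0 < σ →
        FrequencyHopping.rate u v h P σ i ≠ ⊤ ∧
        Rlb ((P : ℝ) / (σ : ℝ) ^ 2) ≤ (FrequencyHopping.rate u v h P σ i).toReal) ∧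
      -- its form
      (∀ γ : ℝ, 0 < γ →
        Rlb γ = FrequencyHopping.multiplexingGain u v i * Real.logb 2 γ + Rlb' γ) ∧
      (∃ l : ℝ, Tendsto Rlb' atTop (𝓝 l)) ∧
      -- its asymptotics, when the coefficient does not vanish
      (1 ≤ v i → (∀ k, k ≠ i → v k < u) →
        Tendsto (fun γ : ℝ =>
          Rlb γ / (FrequencyHopping.multiplexingGain u v i * Real.logb 2 γ)) atTop (𝓝 1)) := by
  refine ⟨fun γ => FrequencyHopping.multiplexingGain u v i * Real.logb 2 γ
      + FrequencyHopping.rateOffset u v h i, fun _ => FrequencyHopping.rateOffset u v h i,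
    fun P σ hP hσ => ⟨FrequencyHopping.rate_ne_top hv h P hσ i,
      FrequencyHopping.le_toReal_rate hv hP hσ hi⟩,
    fun γ _ => rfl, ⟨_, tendsto_const_nhds⟩, fun hvi hvk => ?_⟩
  have hgain := FrequencyHopping.multiplexingGain_pos hvi hvk
  have hinf : Tendsto (fun γ : ℝ => FrequencyHopping.multiplexingGain u v i * Real.logb 2 γ)
      atTop atTop := (Real.tendsto_logb_atTop one_lt_two).const_mul_atTop hgain
  -- Where the main term is nonzero, the quotient is `1` plus a constant over a quantity tending to
  -- infinity.
  have hlim := (hinf.const_div_atTop (FrequencyHopping.rateOffset u v h i)).const_add 1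
  rw [add_zero] at hlim
  refine hlim.congr' ?_
  filter_upwards [hinf.eventually_gt_atTop 0] with γ hγ
  rw [add_div, div_self hγ.ne']
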